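/- **Setting.** For a finite alphabet $\Sigma$ and a next-token generator $f:\Sigma^*\to\Sigma$, let $\bar f(x)=\mathrm{append}(x,f(x))$, and for $T\ge 1$ let $f^{\mathsf{e2e}\text{-}T}(x)$ be the last token of $\bar f\circ\cdots\circ\bar f\,(x)$ ($T$ times). For a base class $\mathcal F\subseteq\Sigma^{\Sigma^*}$ let $\mathsf{e2e}^T(\mathcal F)=\{f^{\mathsf{e2e}\text{-}T}: f\in\mathcal F\}$. All dimensions take values in $\mathbb N\cup\{\infty\}$. $\mathrm{VCdim}$ and $\mathrm{Ndim}$ are the Vapnik–Chervonenkis and Natarajan dimensions. $\mathrm{Ldim}(\mathcal F)$ is the Littlestone dimension, i.e. the largest depth $d$ of a complete binary tree, with nodes labeled by $\Sigma^*$, such that for every root-to-leaf path $\epsilon\in\{0,1\}^d$, with node labels $x_1(\epsilon),\dots,x_d(\epsilon)$, some $f\in\mathcal F$ has $f(x_i(\epsilon))=\epsilon_i$ for all $i$. For $\Sigma=\{0,\dots,k-1\}$, $\mathrm{sfat}_1(\mathcal F)$ is the sequential fat-shattering dimension at scale $1$, i.e. the largest depth $d$ of such a tree $x$ for which there is a real-valued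 tree $s$ of depth $d$ such that for every $\epsilon\in\{\pm1\}^d$ some $f\in\mathcal F$ has $\epsilon_i\,(f(x_i(\epsilon))-s_i(\epsilon))\ge \tfrac12$ for all $i$. Here $\log$ is the natural logarithm. A learning rule $A$ maps finite labeled samples to predictors $\Sigma^*\to\Sigma$. It *learns $\mathsf{e2e}^T(\mathcal F)$ end-to-end with sample complexity $m(\varepsilon,\delta)$* if for every probability distribution $\mathcal D$ on $\Sigma^*$, every $f_*\in\mathcal F$ and all $0<\varepsilon,\delta<1$, with probability at least $1-\delta$ over $m=m(\varepsilon,\delta)$ i.i.d. draws $x_1,\dots,x_m\sim\mathcal D$, the predictor $h=A\big((x_i,f_*^{\mathsf{e2e}\text{-}T}(x_i))_{i\le m}\big)$ satisfies $\Pr_{x\sim\mathcal D}\big(h(x)\ne f_*^{\mathsf{e2e}\text{-}T}(x)\big)\le\varepsilon$. The rule $A$ *implements $\mathrm{Cons}_{\mathsf{e2e}}$* if on every sample that is consistent with some member of $\mathsf{e2e}^T(\mathcal F)$ it returns $\hat f^{\mathsf{e2e}\text{-}T}$ for some $\hat f\in\mathcal F$ such that $\hat f^{\mathsf{e2e}\text{-}T}$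 is consistent with the sample. **Theorem.** 1. Let $\Sigma=\{0,1\}$, $\mathcal F\subseteq\Sigma^{\Sigma^*}$ and $T\ge 2$. Then $$\mathrm{VCdim}(\mathsf{e2e}^T(\mathcal F))\le 10\,\mathrm{Ldim}(\mathcal F)\,\log T .$$ 2. Let $\Sigma=\{0,\dots,k-1\}$, $\mathcal F\subseteq\Sigma^{\Sigma^*}$ and $T\ge 1$. Then $$\mathrm{Ndim}(\mathsf{e2e}^T(\mathcal F))\le 20\,\mathrm{sfat}_1(\mathcal F)\,\log (T|\Sigma|) .$$ 3. Let $\Sigma=\{0,1\}$. For every $\varepsilon_0\in(0,1)$ there is a constant $C>0$, depending only on $\varepsilon_0$, such that for every $\mathcal F\subseteq\Sigma^{\Sigma^*}$ with $\mathrm{Ldim}(\mathcal F)<\infty$ and every $T\ge 2$ there is a function $m:(0,1)^2\to\mathbb N$ with the following properties: there are rules that implement $\mathrm{Cons}_{\mathsf{e2e}}$; each of them learns $\mathsf{e2e}^T(\mathcal F)$ end-to-end with sample complexity $m$; and $$m(\varepsilon,\delta)\le C\,\varepsilon^{-1}\Big(\mathrm{Ldim}(\mathcal F)\,\log T\,\log(\varepsilon^{-1})+\log(\delta^{-1})\Big)\qquad(0<\varepsilon\le\varepsilon_0,\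 0<\delta<1).$$ -/

import Mathlib

open scoped ENNReal
open MeasureTheory

namespace AutoregressiveCoT

/-! ### Autoregressive generation -/

section Generation

variable {A : Type*}

/-- The apply-and-append map `x ↦ append(x, f(x))` of a next-token generator `f`. -/
def applyAppend (f : List A → A) (x : List A) : List A := x ++ [f x]

/-- The `T`-step chain of thought: `applyAppend f` iterated `T` times. -/
def cot (f : List A → A) (T : ℕ) (x : List A) : List A := (applyAppend f)^[T] x

/-- The end-to-end map: the last token of the `T`-step chain of thought. For `T ≥ 1` the chain of
thought is a nonempty string and the default value `f x` of `getLastD` plays no role. -/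
def e2e (f : List A → A) (T : ℕ) (x : List A) : A := (cot f T x).getLastD (f x)

/-- The end-to-end class of a base class `F`. -/
def e2eClass (F : Set (List A → A)) (T : ℕ) : Set (List A → A) := (fun f => e2e f T) '' F

end Generation

/-! ### Dimensions -/

section Dimensions

variable {X Y : Type*}

/-- `H(S)`: the behaviors of the class `H` on the points `S 0, …, S (m - 1)`. -/
def behaviors (H : Set (X → Y)) {m : ℕ} (S : Fin m → X) : Set (Fin m → Y) :=
  (fun h i => h (S i)) '' H

/-- `H` shatters the tuple `S` of length `m` if it has `2 ^ m` behaviors on it. -/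
def Shatters (H : Set (X → Bool)) {m : ℕ} (S : Fin m → X) : Prop :=
  (behaviors H S).ncard = 2 ^ m

/-- The Vapnik-Chervonenkis dimension: the largest length of a shattered tuple (`⊤` if there are
arbitrarily long ones). -/
noncomputable def vcDim (H : Set (X → Bool)) : ℕ∞ :=
  ⨆ (m : ℕ) (_ : ∃ S : Fin m → X, Shatters H S), (m : ℕ∞)

/-- An `X`-labeled complete binary tree of depth `d`: the node reached from the root by a path of
length `i < d` carries a label. -/
abbrev LabeledTree (X : Type*) (d : ℕ) := ∀ i : Fin d, (Fin i → Bool) → X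

/-- The label that the tree `x` carries at level `i` on the path `ε`. -/
def LabeledTree.label {d : ℕ} (x : LabeledTree X d) (ε : Fin d → Bool) (i : Fin d) : X :=
  x i fun j => ε (Fin.castLE i.isLt.le j)

/-- `H` shatters the tree `x`: every path is realized by some member of `H`. -/
def ShattersTree (H : Set (X → Bool)) {d : ℕ} (x : LabeledTree X d) : Prop :=
  ∀ ε : Fin d → Bool, ∃ h ∈ H, ∀ i, h (x.label ε i) = ε i

/-- The Littlestone dimension: the largest depth of a shattered tree. -/
noncomputable def ldim (H : Set (X → Bool)) : ℕ∞ :=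
  ⨆ (d : ℕ) (_ : ∃ x : LabeledTree X d, ShattersTree H x), (d : ℕ∞)

/-- Natarajan shattering of a finite set of points. -/
def NatarajanShatters (H : Set (X → Y)) (S : Finset X) : Prop :=
  ∃ h₀ h₁ : X → Y, (∀ x ∈ S, h₀ x ≠ h₁ x) ∧
    ∀ U ⊆ S, ∃ h ∈ H, (∀ x ∈ U, h x = h₀ x) ∧ ∀ x ∈ S, x ∉ U → h x = h₁ x

/-- The Natarajan dimension: the largest cardinality of a Natarajan-shattered set. -/
noncomputable def natarajanDim (H : Set (X → Y)) : ℕ∞ :=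
  ⨆ (S : Finset X) (_ : NatarajanShatters H S), (S.card : ℕ∞)

/-- `G` sequentially shatters the tree `x` at scale `α`, with some real witness tree `s`. The sign
`ε i ∈ {-1, 1}` is coded by a Boolean. -/
def SeqFatShatters (α : ℝ) (G : Set (X → ℝ)) {d : ℕ} (x : LabeledTree X d) : Prop :=
  ∃ s : LabeledTree ℝ d, ∀ ε : Fin d → Bool, ∃ g ∈ G, ∀ i,
    α / 2 ≤ (if ε i then (1 : ℝ) else -1) * (g (x.label ε i) - s.label ε i)

/-- The sequential fat-shattering dimension at scale `α`. -/
noncomputable def sfatDim (α : ℝ) (G : Set (X → ℝ)) : ℕ∞ :=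
  ⨆ (d : ℕ) (_ : ∃ x : LabeledTree X d, SeqFatShatters α G x), (d : ℕ∞)

/-- A class with values in `{0, …, k - 1}`, read as a class of real-valued functions. -/
def realClass {k : ℕ} (F : Set (X → Fin k)) : Set (X → ℝ) :=
  (fun f x => (((f x : Fin k) : ℕ) : ℝ)) '' F

end Dimensions

/-! ### End-to-end learning over the binary alphabet -/

section Learning

/-- The countable set of binary strings carries the discrete σ-algebra. -/
instance : MeasurableSpace (List Bool) := ⊤

/-- A learning rule maps finite labeled samples to predictors. -/
abbrev LearningRule := List (List Bool × Bool) → List Bool → Bool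

/-- The population 0-1 error of the predictor `h` when `D` is the input distribution and the
labels are given by `e2e f T`. -/
noncomputable def popError (D : Measure (List Bool)) (f : List Bool → Bool) (T : ℕ)
    (h : List Bool → Bool) : ℝ :=
  D.real {x | h x ≠ e2e f T x}

/-- The training sample of prompts `x 0, …, x (n - 1)`, labeled by `e2e f T`. -/
def e2eSample (f : List Bool → Bool) (T : ℕ) {n : ℕ} (x : Fin n → List Bool) :
    List (List Bool × Bool) :=
  List.ofFn fun i => (x i, e2e f T (x i))

/-- The rule `R` learns `e2eClass F T` end-to-end with sample complexity `m(ε, δ)`. -/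
def E2ELearns (F : Set (List Bool → Bool)) (T : ℕ) (R : LearningRule) (m : ℝ → ℝ → ℕ) : Prop :=
  ∀ (D : Measure (List Bool)) [IsProbabilityMeasure D], ∀ f ∈ F, ∀ ε δ : ℝ,
    0 < ε → ε < 1 → 0 < δ → δ < 1 →
      1 - δ ≤ (Measure.pi fun _ : Fin (m ε δ) => D).real
        {x | popError D f T (R (e2eSample f T x)) ≤ ε}

/-- `R` implements the end-to-end consistency rule: on every sample that some member of
`e2eClass F T` fits, it returns `e2e f T` for some `f ∈ F` that fits the sample. -/
def IsConsE2E (F : Set (List Bool → Bool)) (T : ℕ) (R : LearningRule) : Prop :=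
  ∀ S : List (List Bool × Bool), (∃ f ∈ F, ∀ p ∈ S, e2e f T p.1 = p.2) →
    ∃ f ∈ F, R S = e2e f T ∧ ∀ p ∈ S, e2e f T p.1 = p.2

end Learning

end AutoregressiveCoT

open AutoregressiveCoT

/-!
The first `n` tokens of a chain of thought are computed by `n` adaptive evaluations of the
generator, so the end-to-end labels of `m` prompts are the leaf reached by `f` in a decision tree
of depth `m * T` whose nodes query `f`. Induction over this tree, as in the Sauer-Shelah lemma for
Littlestone classes, bounds the number of leaves reached by a class of Littlestone dimension `d` by
`∑ i ≤ d, (m * T).choose i * (|Σ| - 1) ^ i`. This growth function is of order `(m * T * |Σ|) ^ d`,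
so a shattered set, on which it is at least `2 ^ m`, satisfies `m = O(d * log (T * |Σ|))`.

For learning, draw a second, ghost sample. A set that misses the sample is given the weight
`2 ^ (number of ghost points in it)`; for a set of measure at least `ε` its expectation over the
ghost sample is at least `(1 + ε) ^ m`. Exchanging the points of each sample-ghost pair at random
averages this weight to at most one for each of the traces of the class on the `2 * m` points.
Hence a consistent hypothesis of error above `ε` exists with probability at most
`(number of traces) / (1 + ε) ^ m`.
-/

namespace AutoregressiveCoT

section Queries

variable {X Y Z W : Type*}

/-- `φ f` can be computed by `n` adaptive evaluations of `f`: a decision tree of depth `n` whose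
inner nodes query `f` at a point and whose leaves carry the values of `φ`. -/
inductive QueryComputable : ℕ → ((X → Y) → Z) → Prop
  | const (z : Z) : QueryComputable 0 fun _ => z
  | query {n : ℕ} (x : X) (φ : Y → (X → Y) → Z) (h : ∀ y, QueryComputable n (φ y)) :
      QueryComputable (n + 1) fun f => φ (f x) f

theorem queryComputable_eval (x : X) : QueryComputable 1 fun f : X → Y => f x :=
  .query x (fun y _ => y) .const

theorem QueryComputable.bind {n m : ℕ} {φ : (X → Y) → Z} (hφ : QueryComputable n φ)
    {ψ : Z → (X → Y) → W} (hψ : ∀ z, QueryComputable m (ψ z)) :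
    QueryComputable (n + m) fun f => ψ (φ f) f := by
  induction hφ with
  | const z => simpa using hψ z
  | query x φ _ ih =>
    rw [Nat.add_right_comm]
    exact .query x (fun y f => ψ (φ y f) f) ih

theorem QueryComputable.map {n : ℕ} {φ : (X → Y) → Z} (hφ : QueryComputable n φ) (g : Z → W) :
    QueryComputable n fun f => g (φ f) :=
  hφ.bind (ψ := fun z _ => g z) fun z => .const (g z)

theorem QueryComputable.finPi {n m : ℕ} {ψ : Fin m → (X → Y) → Z}
    (hψ : ∀ i, QueryComputable n (ψ i)) : QueryComputable (m * n) fun f i => ψ i f := by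
  induction m with
  | zero =>
    rw [Nat.zero_mul]
    convert QueryComputable.const (X := X) (Y := Y) (Z := Fin 0 → Z) Fin.elim0 using 2
  | succ m ih =>
    have hcons := (ih fun i => hψ i.succ).bind
      (ψ := fun v f => (Fin.cons (ψ 0 f) v : Fin (m + 1) → Z))
      fun v => (hψ 0).map fun z => (Fin.cons z v : Fin (m + 1) → Z)
    rw [Nat.succ_mul]
    convert hcons using 2
    exact (Fin.cons_self_tail _).symm

theorem QueryComputable.pi {ι : Type*} [Fintype ι] {n : ℕ} {ψ : ι → (X → Y) → Z}
    (hψ : ∀ i, QueryComputable n (ψ i)) :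
    QueryComputable (Fintype.card ι * n) fun f i => ψ i f := by
  let e := Fintype.equivFin ι
  simpa [e] using
    (QueryComputable.finPi fun j => hψ (e.symm j)).map fun (v : _ → Z) (i : ι) => v (e i)

theorem queryComputable_cot (T : ℕ) (x : List Y) :
    QueryComputable T fun f : List Y → Y => cot f T x := by
  induction T generalizing x with
  | zero => exact .const x
  | succ T ih => exact .query x (fun y f => cot f T (x ++ [y])) fun y => ih _

theorem e2e_succ (f : List Y → Y) (T : ℕ) (x : List Y) : e2e f (T + 1) x = f (cot f T x) := by
  simp [e2e, cot, Function.iterate_succ_apply', applyAppend]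

theorem queryComputable_e2e {T : ℕ} (hT : 1 ≤ T) (x : List Y) :
    QueryComputable T fun f : List Y → Y => e2e f T x := by
  obtain ⟨T, rfl⟩ := Nat.exists_eq_add_of_le' hT
  simp only [e2e_succ]
  exact (queryComputable_cot T x).bind queryComputable_eval

end Queries

section Littlestone

variable {X Y : Type*}

/-- `F` shatters a tree of depth `d` in which each edge carries one of two distinct labels that
depend on its upper node, the notion behind the multiclass Littlestone dimension. The tree is built
from its root, so that the subtrees are shattered by the restrictions of `F`. -/
def LittlestoneShatters : ℕ → Set (X → Y) → Prop
  | 0, F => F.Nonempty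
  | d + 1, F => ∃ (x : X) (y₀ y₁ : Y), y₀ ≠ y₁ ∧
      LittlestoneShatters d {f ∈ F | f x = y₀} ∧ LittlestoneShatters d {f ∈ F | f x = y₁}

/-- The Littlestone dimension of a class with values in an arbitrary label set. -/
noncomputable def littlestoneDim (F : Set (X → Y)) : ℕ∞ :=
  ⨆ (d : ℕ) (_ : LittlestoneShatters d F), (d : ℕ∞)

theorem not_littlestoneShatters_succ {F : Set (X → Y)} {d : ℕ} (hd : littlestoneDim F ≤ d) :
    ¬ LittlestoneShatters (d + 1) F := fun h =>
  (Nat.lt_succ_self d).not_ge <| Nat.cast_le.1 <|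
    (le_iSup₂_of_le (f := fun d (_ : LittlestoneShatters d F) => (d : ℕ∞)) _ h le_rfl).trans hd

theorem LittlestoneShatters.mono {d : ℕ} {F G : Set (X → Y)} (h : LittlestoneShatters d F)
    (hFG : F ⊆ G) : LittlestoneShatters d G := by
  induction d generalizing F G with
  | zero => exact Set.Nonempty.mono hFG h
  | succ d ih =>
    obtain ⟨x, y₀, y₁, hne, h₀, h₁⟩ := h
    exact ⟨x, y₀, y₁, hne, ih h₀ fun f hf => ⟨hFG hf.1, hf.2⟩, ih h₁ fun f hf => ⟨hFG hf.1, hf.2⟩⟩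

theorem subsingleton_of_not_littlestoneShatters_one {F : Set (X → Y)}
    (hF : ¬ LittlestoneShatters 1 F) : F.Subsingleton := by
  intro f hf g hg
  by_contra hne
  obtain ⟨x, hx⟩ := Function.ne_iff.1 hne
  exact hF ⟨x, f x, g x, hx, ⟨f, hf, rfl⟩, ⟨g, hg, rfl⟩⟩

theorem exists_forall_ne_not_littlestoneShatters {F : Set (X → Y)} {d : ℕ} (hne : F.Nonempty)
    (hF : ¬ LittlestoneShatters (d + 1) F) (x : X) :
    ∃ y', ∀ y ≠ y', ¬ LittlestoneShatters d {f ∈ F | f x = y} := by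
  by_cases hex : ∃ y', LittlestoneShatters d {f ∈ F | f x = y'}
  · obtain ⟨y', hy'⟩ := hex
    exact ⟨y', fun y hy hsh => hF ⟨x, y, y', hy, hsh, hy'⟩⟩
  · push Not at hex
    obtain ⟨f, -⟩ := hne
    exact ⟨f x, fun y _ => hex y⟩

/-- The tree with a given root label and given left and right subtrees. -/
def LabeledTree.node {d : ℕ} (a : X) (t : Bool → LabeledTree X d) : LabeledTree X (d + 1) :=
  fun i => Fin.cases (motive := fun i : Fin (d + 1) => (Fin i → Bool) → X) (fun _ => a)
    (fun j p => t (p ⟨0, Nat.succ_pos j⟩) j fun l => p ⟨l + 1, Nat.succ_lt_succ l.isLt⟩) i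

theorem LittlestoneShatters.exists_labeledTree [LinearOrder Y] {d : ℕ} {F : Set (X → Y)}
    (h : LittlestoneShatters d F) :
    ∃ (x : LabeledTree X d) (lo hi : LabeledTree Y d), ∀ ε,
      (∀ i, lo.label ε i < hi.label ε i) ∧
        ∃ f ∈ F, ∀ i, f (x.label ε i) = if ε i then hi.label ε i else lo.label ε i := by
  induction d generalizing F with
  | zero =>
    obtain ⟨f, hf⟩ := h
    exact ⟨nofun, nofun, nofun, fun ε => ⟨nofun, f, hf, nofun⟩⟩
  | succ d ih =>
    obtain ⟨x, y₀, y₁, hlt, h₀, h₁⟩ : ∃ (x : X) (y₀ y₁ : Y), y₀ < y₁ ∧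
        LittlestoneShatters d {f ∈ F | f x = y₀} ∧ LittlestoneShatters d {f ∈ F | f x = y₁} := by
      obtain ⟨x, y₀, y₁, hne, h₀, h₁⟩ := h
      rcases hne.lt_or_gt with hlt | hlt
      exacts [⟨x, y₀, y₁, hlt, h₀, h₁⟩, ⟨x, y₁, y₀, hlt, h₁, h₀⟩]
    have hsub : ∀ b : Bool, LittlestoneShatters d {f ∈ F | f x = if b then y₁ else y₀} := by
      rintro (_ | _) <;> simpa
    choose t lo hi ht using fun b => ih (hsub b)
    refine ⟨.node x t, .node y₀ lo, .node y₁ hi, fun ε => ?_⟩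
    obtain ⟨hlohi, f, ⟨hf, hfx⟩, hfi⟩ := ht (ε 0) fun j => ε j.succ
    exact ⟨Fin.cases hlt hlohi, f, hf, Fin.cases hfx hfi⟩

theorem LittlestoneShatters.exists_shattersTree {d : ℕ} {F : Set (X → Bool)}
    (h : LittlestoneShatters d F) : ∃ x : LabeledTree X d, ShattersTree F x := by
  obtain ⟨x, lo, hi, ht⟩ := h.exists_labeledTree
  refine ⟨x, fun ε => ?_⟩
  obtain ⟨hlt, f, hf, hfx⟩ := ht ε
  refine ⟨f, hf, fun i => ?_⟩
  obtain ⟨hlo, hhi⟩ := Bool.lt_iff.1 (hlt i)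
  rw [hfx i, hlo, hhi]
  cases ε i <;> rfl

theorem LittlestoneShatters.exists_seqFatShatters {k d : ℕ} {F : Set (X → Fin k)}
    (h : LittlestoneShatters d F) : ∃ x : LabeledTree X d, SeqFatShatters 1 (realClass F) x := by
  obtain ⟨x, lo, hi, ht⟩ := h.exists_labeledTree
  let mid : LabeledTree ℝ d := fun i p => (((lo i p : ℕ) : ℝ) + ((hi i p : ℕ) : ℝ)) / 2
  refine ⟨x, mid, fun ε => ?_⟩
  obtain ⟨hlt, f, hf, hfx⟩ := ht ε
  refine ⟨_, ⟨f, hf, rfl⟩, fun i => ?_⟩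
  have hgap : ((lo.label ε i : ℕ) : ℝ) + 1 ≤ ((hi.label ε i : ℕ) : ℝ) := by
    exact_mod_cast hlt i
  have hmid : mid.label ε i = (((lo.label ε i : ℕ) : ℝ) + ((hi.label ε i : ℕ) : ℝ)) / 2 := rfl
  simp only [hfx i, hmid]
  cases ε i <;> simp only [Bool.false_eq_true, if_true, if_false] <;> linarith

theorem littlestoneDim_le_ldim (F : Set (X → Bool)) : littlestoneDim F ≤ ldim F :=
  iSup₂_le fun d h => le_iSup₂_of_le d h.exists_shattersTree le_rfl

theorem littlestoneDim_le_sfatDim {k : ℕ} (F : Set (X → Fin k)) :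
    littlestoneDim F ≤ sfatDim 1 (realClass F) :=
  iSup₂_le fun d h => le_iSup₂_of_le d h.exists_seqFatShatters le_rfl

end Littlestone

section SauerShelah

/-- The Sauer-Shelah bound for decision trees of depth `n` with `K + 1` outcomes per query and for
classes that shatter no Littlestone tree of depth `d`. The sum stops before `d`: it has `d` terms,
and Littlestone dimension `d` corresponds to `sauerSum K n (d + 1)`. -/
def sauerSum (K n d : ℕ) : ℕ := ∑ i ∈ Finset.range d, n.choose i * K ^ i

theorem sauerSum_zero_succ (K d : ℕ) : sauerSum K 0 (d + 1) = 1 := by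
  simp [sauerSum, Finset.sum_range_succ']

theorem sauerSum_succ (K n d : ℕ) :
    sauerSum K (n + 1) (d + 1) = sauerSum K n (d + 1) + K * sauerSum K n d := by
  simp only [sauerSum]
  rw [Finset.sum_range_succ', Finset.sum_range_succ' _ d, Finset.mul_sum, add_right_comm,
    ← Finset.sum_add_distrib]
  congr 1
  · refine Finset.sum_congr rfl fun i _ => ?_
    rw [Nat.choose_succ_succ]
    ring
  · simp

theorem QueryComputable.encard_image_le {X Y Z : Type*} [Fintype Y] {n : ℕ} {φ : (X → Y) → Z}
    (hφ : QueryComputable n φ) {d : ℕ} {F : Set (X → Y)} (hF : ¬ LittlestoneShatters d F) :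
    (φ '' F).encard ≤ sauerSum (Fintype.card Y - 1) n d := by
  classical
  induction hφ generalizing d F with
  | const z =>
    cases d with
    | zero => simp [Set.not_nonempty_iff_eq_empty.1 hF]
    | succ d =>
      rw [sauerSum_zero_succ, Nat.cast_one, Set.encard_le_one_iff]
      rintro _ _ ⟨_, _, rfl⟩ ⟨_, _, rfl⟩
      rfl
  | @query n x φ _ ih =>
    rcases F.eq_empty_or_nonempty with rfl | hne
    · simp
    cases d with
    | zero => exact absurd hne hF
    | succ d =>
      obtain ⟨y', hy'⟩ := exists_forall_ne_not_littlestoneShatters hne hF x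
      have hsub : (fun f => φ (f x) f) '' F ⊆ ⋃ y, φ y '' {f ∈ F | f x = y} := by
        rintro _ ⟨f, hf, rfl⟩
        exact Set.mem_iUnion.2 ⟨f x, f, ⟨hf, rfl⟩, rfl⟩
      calc ((fun f => φ (f x) f) '' F).encard
          ≤ ∑ y, (φ y '' {f ∈ F | f x = y}).encard :=
            (Set.encard_le_encard hsub).trans (Set.encard_iUnion_le_of_fintype _)
        _ = (φ y' '' {f ∈ F | f x = y'}).encard +
            ∑ y ∈ Finset.univ.erase y', (φ y '' {f ∈ F | f x = y}).encard :=
            (Finset.add_sum_erase _ _ (Finset.mem_univ y')).symm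
        _ ≤ sauerSum (Fintype.card Y - 1) n (d + 1) +
            ∑ _y ∈ Finset.univ.erase y', (sauerSum (Fintype.card Y - 1) n d : ℕ∞) :=
            add_le_add (ih y' fun hsh => hF (hsh.mono fun f hf => hf.1))
              (Finset.sum_le_sum fun y hy => ih y (hy' y (Finset.ne_of_mem_erase hy)))
        _ = sauerSum (Fintype.card Y - 1) (n + 1) (d + 1) := by
            rw [Finset.sum_const, Finset.card_erase_of_mem (Finset.mem_univ _), Finset.card_univ,
              sauerSum_succ, nsmul_eq_mul]
            push_cast
            rfl

/-- Chernoff's argument: `x ^ d ≤ x ^ i` for `i ≤ d`, and what remains is dominated by the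
exponential series. -/
theorem sauerSum_mul_pow_le_exp (K n d : ℕ) {x : ℝ} (hx₀ : 0 ≤ x) (hx₁ : x ≤ 1) :
    (sauerSum K n (d + 1) : ℝ) * x ^ d ≤ Real.exp (n * K * x) := by
  have hterm : ∀ i ∈ Finset.range (d + 1),
      ((n.choose i * K ^ i : ℕ) : ℝ) * x ^ d ≤ (n * K * x) ^ i / i.factorial := by
    intro i hi
    calc ((n.choose i * K ^ i : ℕ) : ℝ) * x ^ d = n.choose i * K ^ i * x ^ d := by push_cast; rfl
      _ ≤ n ^ i / i.factorial * K ^ i * x ^ i := by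
        have hid : i ≤ d := Finset.mem_range_succ_iff.1 hi
        gcongr ?_ * _ * ?_
        · exact Nat.choose_le_pow_div i n
        · exact pow_le_pow_of_le_one hx₀ hx₁ hid
      _ = (n * K * x) ^ i / i.factorial := by ring
  rw [sauerSum, Nat.cast_sum, Finset.sum_mul]
  exact (Finset.sum_le_sum hterm).trans (Real.sum_le_exp_of_nonneg (by positivity) _)

theorem le_mul_log_of_two_pow_le_sauerSum {K T m d : ℕ} {M : ℝ} (hM : 2 ≤ M)
    (hTM : (T : ℝ) * K ≤ M) (h : 2 ^ m ≤ sauerSum K (m * T) (d + 1)) :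
    (m : ℝ) ≤ 10 * (d * Real.log M) := by
  have hM₀ : 0 < M := by linarith
  have hexp : (2 : ℝ) ^ m * (4 * M)⁻¹ ^ d ≤ Real.exp (m / 4) :=
    calc (2 : ℝ) ^ m * (4 * M)⁻¹ ^ d ≤ sauerSum K (m * T) (d + 1) * (4 * M)⁻¹ ^ d := by
          gcongr
          exact_mod_cast h
      _ ≤ Real.exp ((m * T : ℕ) * K * (4 * M)⁻¹) :=
          sauerSum_mul_pow_le_exp _ _ _ (by positivity) (inv_le_one_of_one_le₀ (by linarith))
      _ ≤ Real.exp (m / 4) := by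
          gcongr
          calc ((m * T : ℕ) : ℝ) * K * (4 * M)⁻¹ = m * (T * K) * (4 * M)⁻¹ := by push_cast; ring
            _ ≤ m * M * (4 * M)⁻¹ := by gcongr
            _ = m / 4 := by field_simp
  have hlog : m * Real.log 2 ≤ d * (2 * Real.log 2 + Real.log M) + m / 4 := by
    have hlog4 : Real.log 4 = 2 * Real.log 2 := by
      rw [show (4 : ℝ) = 2 ^ 2 by norm_num, Real.log_pow, Nat.cast_ofNat]
    have := Real.log_le_log (by positivity) hexp
    rw [Real.log_exp, Real.log_mul (by positivity) (by positivity), Real.log_pow, Real.log_pow,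
      Real.log_inv, Real.log_mul (by norm_num) hM₀.ne', hlog4] at this
    linarith
  have hlogM : d * Real.log 2 ≤ d * Real.log M := by gcongr
  nlinarith [Real.log_two_gt_d9, (Nat.cast_nonneg m : (0 : ℝ) ≤ m)]

end SauerShelah

section GrowthFunction

variable {Y : Type*} [Fintype Y]

theorem encard_image_e2eClass_le {ι : Type*} [Fintype ι] {F : Set (List Y → Y)} {d T : ℕ}
    (hF : ¬ LittlestoneShatters d F) (hT : 1 ≤ T) (S : ι → List Y) :
    ((fun h i => h (S i)) '' e2eClass F T).encard ≤
      sauerSum (Fintype.card Y - 1) (Fintype.card ι * T) d := by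
  rw [e2eClass, Set.image_image]
  exact (QueryComputable.pi fun i => queryComputable_e2e hT (S i)).encard_image_le hF

theorem card_le_of_two_pow_le_encard_image_e2eClass {ι : Type*} [Fintype ι] {F : Set (List Y → Y)}
    {T : ℕ} (hT : 1 ≤ T) {S : ι → List Y}
    (hS : (2 : ℕ∞) ^ Fintype.card ι ≤ ((fun h i => h (S i)) '' e2eClass F T).encard)
    {M : ℝ} (hM : 2 ≤ M) (hTM : (T : ℝ) * (Fintype.card Y - 1 : ℕ) ≤ M) :
    (Fintype.card ι : ℝ≥0∞) ≤ 10 * littlestoneDim F * ENNReal.ofReal (Real.log M) := by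
  have hlog : 0 < Real.log M := Real.log_pos (by linarith)
  rcases eq_or_ne (littlestoneDim F) ⊤ with htop | hfin
  · simp [htop, ENNReal.mul_top, ENNReal.top_mul, hlog]
  obtain ⟨d, hd⟩ := ENat.ne_top_iff_exists.1 hfin
  have hgrowth : 2 ^ Fintype.card ι ≤
      sauerSum (Fintype.card Y - 1) (Fintype.card ι * T) (d + 1) := by
    exact_mod_cast hS.trans
      (encard_image_e2eClass_le (not_littlestoneShatters_succ hd.ge) hT S)
  calc (Fintype.card ι : ℝ≥0∞) = ENNReal.ofReal (Fintype.card ι) :=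
        (ENNReal.ofReal_natCast _).symm
    _ ≤ ENNReal.ofReal (10 * (d * Real.log M)) :=
        ENNReal.ofReal_le_ofReal (le_mul_log_of_two_pow_le_sauerSum hM hTM hgrowth)
    _ = 10 * littlestoneDim F * ENNReal.ofReal (Real.log M) := by
        rw [← hd, ENNReal.ofReal_mul (by norm_num), ENNReal.ofReal_mul (by positivity),
          ENNReal.ofReal_natCast, ENNReal.ofReal_ofNat, mul_assoc, ENat.toENNReal_coe]

theorem vcDim_e2eClass_le (F : Set (List Bool → Bool)) {T : ℕ} (hT : 2 ≤ T) :
    (vcDim (e2eClass F T) : ℝ≥0∞) ≤ 10 * littlestoneDim F * ENNReal.ofReal (Real.log T) := by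
  simp only [vcDim, ENat.toENNReal_iSup, ENat.toENNReal_coe]
  refine iSup₂_le fun m ⟨S, hS⟩ => ?_
  have hS' : (2 : ℕ∞) ^ Fintype.card (Fin m) ≤
      ((fun h i => h (S i)) '' e2eClass F T).encard := by
    rw [Fintype.card_fin]
    exact_mod_cast hS ▸ Set.ncard_le_encard _
  simpa using card_le_of_two_pow_le_encard_image_e2eClass (by omega) hS' (M := T)
    (by exact_mod_cast hT) (by simp)

theorem NatarajanShatters.two_pow_card_le {X Y : Type*} {H : Set (X → Y)} {S : Finset X}
    (hS : NatarajanShatters H S) :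
    (2 : ℕ∞) ^ S.card ≤ ((fun h (x : S) => h x) '' H).encard := by
  classical
  obtain ⟨h₀, h₁, hne, hH⟩ := hS
  let pattern : Finset S → S → Y := fun U x => if x ∈ U then h₀ x else h₁ x
  have hinj : Function.Injective pattern := by
    have hmem : ∀ (U : Finset S) (x : S), x ∈ U ↔ pattern U x = h₀ x := fun U x => by
      simp [pattern, (hne x x.2).symm]
    exact fun U V hUV => Finset.ext fun x => by rw [hmem, hmem, hUV]
  have hrange : Set.range pattern ⊆ (fun h (x : S) => h x) '' H := by
    rintro _ ⟨U, rfl⟩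
    obtain ⟨h, hh, hU, hUc⟩ := hH (U.map (.subtype _)) (Finset.map_subtype_subset U)
    refine ⟨h, hh, funext fun x => ?_⟩
    by_cases hx : x ∈ U
    · simp [pattern, hx, hU x (by simpa using hx)]
    · simp [pattern, hx, hUc x x.2 (by simpa using hx)]
  calc (2 : ℕ∞) ^ S.card = ENat.card (Finset S) := by simp [ENat.card_eq_coe_fintype_card]
    _ ≤ (Set.range pattern).encard := hinj.encard_range
    _ ≤ _ := Set.encard_le_encard hrange

theorem NatarajanShatters.eq_empty {X Y : Type*} [Subsingleton Y] {H : Set (X → Y)} {S : Finset X}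
    (hS : NatarajanShatters H S) : S = ∅ := by
  obtain ⟨h₀, h₁, hne, -⟩ := hS
  exact Finset.eq_empty_of_forall_notMem fun x hx => hne x hx (Subsingleton.elim _ _)

theorem natarajanDim_e2eClass_le (F : Set (List Y → Y)) {T : ℕ} (hT : 1 ≤ T) :
    (natarajanDim (e2eClass F T) : ℝ≥0∞) ≤
      10 * littlestoneDim F * ENNReal.ofReal (Real.log (T * Fintype.card Y)) := by
  simp only [natarajanDim, ENat.toENNReal_iSup, ENat.toENNReal_coe]
  refine iSup₂_le fun S hS => ?_
  rcases subsingleton_or_nontrivial Y with _ | _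
  · simp [hS.eq_empty]
  · have hcard : (2 : ℝ) ≤ Fintype.card Y := by exact_mod_cast Fintype.one_lt_card (α := Y)
    have hT' : (1 : ℝ) ≤ T := by exact_mod_cast hT
    have hS' := hS.two_pow_card_le
    rw [← Fintype.card_coe S] at hS'
    simpa using card_le_of_two_pow_le_encard_image_e2eClass hT hS' (M := T * Fintype.card Y)
      (by nlinarith) (by gcongr; exact Nat.sub_le _ _)

end GrowthFunction

section GhostSample

variable {ι X Y : Type*}

/-- The permutation of the indices of a double sample that exchanges `inl i` with `inr i` whenever
`σ i` is set. -/
def pairSwap (σ : ι → Bool) : Equiv.Perm (ι ⊕ ι) :=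
  Function.Involutive.toPerm (fun j => if σ (j.elim id id) then j.swap else j) <| by
    rintro (i | i) <;> cases h : σ i <;> simp [h]

theorem pairSwap_inl (σ : ι → Bool) (i : ι) :
    pairSwap σ (.inl i) = if σ i then .inr i else .inl i := rfl

theorem pairSwap_inr (σ : ι → Bool) (i : ι) :
    pairSwap σ (.inr i) = if σ i then .inl i else .inr i := rfl

variable [Fintype ι]

open scoped Classical in
/-- The weight of the trace `A` of a set on a double sample, whose first half `inl` is the sample
and whose second half `inr` is the ghost sample: `2 ^ (number of ghost points)` if the trace
contains no sample point, and `0` otherwise. -/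
noncomputable def ghostWeight (A : Set (ι ⊕ ι)) : ℝ≥0∞ :=
  ∏ i, if .inl i ∈ A then 0 else if .inr i ∈ A then 2 else 1

/-- The largest weight of the trace of a member of `𝓔` on the double sample `y`. -/
noncomputable def maxGhostWeight (𝓔 : Set (Set X)) (y : ι ⊕ ι → X) : ℝ≥0∞ :=
  ⨆ E ∈ 𝓔, ghostWeight (y ⁻¹' E)

theorem sum_ghostWeight_preimage_pairSwap_le [DecidableEq ι] (A : Set (ι ⊕ ι)) :
    ∑ σ : ι → Bool, ghostWeight (pairSwap σ ⁻¹' A) ≤ 2 ^ Fintype.card ι := by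
  classical
  let factor (i : ι) (b : Bool) : ℝ≥0∞ :=
    if (if b then .inr i else .inl i) ∈ A then 0
    else if (if b then .inl i else .inr i) ∈ A then 2 else 1
  have hfactor : ∀ i, ∑ b, factor i b ≤ 2 := by
    intro i
    by_cases hl : Sum.inl i ∈ A <;> by_cases hr : Sum.inr i ∈ A <;>
      simp [factor, hl, hr, one_add_one_eq_two]
  calc ∑ σ : ι → Bool, ghostWeight (pairSwap σ ⁻¹' A) = ∑ σ : ι → Bool, ∏ i, factor i (σ i) := by
        simp only [ghostWeight, Set.mem_preimage, pairSwap_inl, pairSwap_inr, factor]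
    _ = ∏ i, ∑ b, factor i b := (Fintype.prod_sum factor).symm
    _ ≤ ∏ _i : ι, 2 := Finset.prod_le_prod' fun i _ => hfactor i
    _ = 2 ^ Fintype.card ι := by simp

theorem sum_maxGhostWeight_comp_pairSwap_le [DecidableEq ι] {𝓔 : Set (Set X)} {N : ℕ}
    {y : ι ⊕ ι → X} (hN : ((fun E => y ⁻¹' E) '' 𝓔).encard ≤ N) :
    ∑ σ : ι → Bool, maxGhostWeight 𝓔 (y ∘ pairSwap σ) ≤ N * 2 ^ Fintype.card ι := by
  have hfin := Set.finite_of_encard_le_coe hN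
  have hcard : hfin.toFinset.card ≤ N := by
    rw [hfin.encard_eq_coe_toFinset_card] at hN
    exact_mod_cast hN
  have hmax : ∀ σ : ι → Bool, maxGhostWeight 𝓔 (y ∘ pairSwap σ) ≤
      ∑ A ∈ hfin.toFinset, ghostWeight (pairSwap σ ⁻¹' A) := fun σ =>
    iSup₂_le fun E hE =>
      Finset.single_le_sum (f := fun A => ghostWeight (pairSwap σ ⁻¹' A)) (fun _ _ => zero_le)
        (hfin.mem_toFinset.2 ⟨E, hE, rfl⟩)
  calc ∑ σ : ι → Bool, maxGhostWeight 𝓔 (y ∘ pairSwap σ)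
      ≤ ∑ σ : ι → Bool, ∑ A ∈ hfin.toFinset, ghostWeight (pairSwap σ ⁻¹' A) :=
        Finset.sum_le_sum fun σ _ => hmax σ
    _ = ∑ A ∈ hfin.toFinset, ∑ σ : ι → Bool, ghostWeight (pairSwap σ ⁻¹' A) := Finset.sum_comm
    _ ≤ ∑ _A ∈ hfin.toFinset, 2 ^ Fintype.card ι :=
        Finset.sum_le_sum fun A _ => sum_ghostWeight_preimage_pairSwap_le A
    _ ≤ N * 2 ^ Fintype.card ι := by
        rw [Finset.sum_const, nsmul_eq_mul]
        gcongr

variable [MeasurableSpace X]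

theorem measurePreserving_comp_perm (D : Measure X) [SigmaFinite D] (e : Equiv.Perm ι) :
    MeasurePreserving (fun y : ι → X => y ∘ e) (Measure.pi fun _ => D) (Measure.pi fun _ => D) :=
  measurePreserving_arrowCongr' (fun _ => D) (fun _ => D) e.symm (.refl X) fun _ => .id D

theorem lintegral_pi_prod_eq_pow (D : Measure X) [IsProbabilityMeasure D] {g : X → ℝ≥0∞}
    (hg : Measurable g) :
    ∫⁻ x, ∏ i : ι, g (x i) ∂(Measure.pi fun _ => D) = (∫⁻ y, g y ∂D) ^ Fintype.card ι := by
  have hind := ProbabilityTheory.iIndepFun_pi (μ := fun _ : ι => D) (X := fun _ => g)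
    fun _ => hg.aemeasurable
  have heval : ∀ i : ι, ∫⁻ x, g (x i) ∂(Measure.pi fun _ : ι => D) = ∫⁻ y, g y ∂D := fun i =>
    (measurePreserving_eval (fun _ : ι => D) i).lintegral_comp hg
  rw [ProbabilityTheory.lintegral_prod_eq_prod_lintegral_of_indepFun Finset.univ _ hind
    fun i => hg.comp (measurable_pi_apply i)]
  simp [heval]

theorem one_add_pow_le_lintegral_maxGhostWeight (D : Measure X) [IsProbabilityMeasure D]
    {𝓔 : Set (Set X)} {E : Set X} (hE : E ∈ 𝓔) (hEm : MeasurableSet E) {x : ι → X}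
    (hx : ∀ i, x i ∉ E) :
    (1 + D E) ^ Fintype.card ι ≤
      ∫⁻ x', maxGhostWeight 𝓔 (Sum.elim x x') ∂(Measure.pi fun _ => D) := by
  have hweight : ∀ x' : ι → X,
      ghostWeight (Sum.elim x x' ⁻¹' E) = ∏ i, (1 + E.indicator 1 (x' i)) := fun x' =>
    Finset.prod_congr rfl fun i _ => by
      by_cases hi : x' i ∈ E <;> simp [hx i, hi, one_add_one_eq_two]
  calc (1 + D E) ^ Fintype.card ι = (∫⁻ y, (1 + E.indicator 1 y) ∂D) ^ Fintype.card ι := by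
        rw [lintegral_add_left measurable_const, lintegral_indicator_one hEm]
        simp
    _ = ∫⁻ x', ∏ i, (1 + E.indicator 1 (x' i)) ∂(Measure.pi fun _ => D) :=
        (lintegral_pi_prod_eq_pow D (measurable_const.add (measurable_one.indicator hEm))).symm
    _ ≤ ∫⁻ x', maxGhostWeight 𝓔 (Sum.elim x x') ∂(Measure.pi fun _ => D) :=
        lintegral_mono fun x' => (hweight x').ge.trans
          (le_iSup₂ (f := fun E (_ : E ∈ 𝓔) => ghostWeight (Sum.elim x x' ⁻¹' E)) E hE)

variable [Countable X] [DiscreteMeasurableSpace X]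

theorem lintegral_maxGhostWeight_le (D : Measure X) [IsProbabilityMeasure D] {𝓔 : Set (Set X)}
    {N : ℕ} (hN : ∀ y : ι ⊕ ι → X, ((fun E => y ⁻¹' E) '' 𝓔).encard ≤ N) :
    ∫⁻ y, maxGhostWeight 𝓔 y ∂(Measure.pi fun _ : ι ⊕ ι => D) ≤ N := by
  classical
  set μ := Measure.pi fun _ : ι ⊕ ι => D
  have hswap : ∀ σ : ι → Bool,
      ∫⁻ y, maxGhostWeight 𝓔 (y ∘ pairSwap σ) ∂μ = ∫⁻ y, maxGhostWeight 𝓔 y ∂μ := fun σ =>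
    (measurePreserving_comp_perm D (pairSwap σ)).lintegral_comp .of_discrete
  refine (ENNReal.mul_le_mul_iff_left (c := 2 ^ Fintype.card ι) (by positivity)
    (ENNReal.pow_ne_top (by simp))).1 ?_
  calc (∫⁻ y, maxGhostWeight 𝓔 y ∂μ) * 2 ^ Fintype.card ι
      = ∑ σ : ι → Bool, ∫⁻ y, maxGhostWeight 𝓔 (y ∘ pairSwap σ) ∂μ := by
        simp [hswap, mul_comm]
    _ = ∫⁻ y, ∑ σ : ι → Bool, maxGhostWeight 𝓔 (y ∘ pairSwap σ) ∂μ :=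
        (lintegral_finsetSum _ fun _ _ => .of_discrete).symm
    _ ≤ ∫⁻ _, (N : ℝ≥0∞) * 2 ^ Fintype.card ι ∂μ :=
        lintegral_mono fun y => sum_maxGhostWeight_comp_pairSwap_le (hN y)
    _ = N * 2 ^ Fintype.card ι := by simp [μ]

theorem measure_exists_disjoint_le (D : Measure X) [IsProbabilityMeasure D] {𝓔 : Set (Set X)}
    {N : ℕ} (hN : ∀ y : ι ⊕ ι → X, ((fun E => y ⁻¹' E) '' 𝓔).encard ≤ N) (ε : ℝ≥0∞) :
    Measure.pi (fun _ : ι => D) {x | ∃ E ∈ 𝓔, (∀ i, x i ∉ E) ∧ ε ≤ D E} ≤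
      N / (1 + ε) ^ Fintype.card ι := by
  set μ := Measure.pi fun _ : ι => D
  set bad : Set (ι → X) := {x | ∃ E ∈ 𝓔, (∀ i, x i ∉ E) ∧ ε ≤ D E}
  have hsplit := measurePreserving_sumPiEquivProdPi_symm fun _ : ι ⊕ ι => D
  rw [ENNReal.le_div_iff_mul_le (.inl (by positivity)) (.inr (ENNReal.natCast_ne_top N)), mul_comm]
  calc (1 + ε) ^ Fintype.card ι * μ bad = ∫⁻ _ in bad, (1 + ε) ^ Fintype.card ι ∂μ := by
        rw [setLIntegral_const]
    _ ≤ ∫⁻ x in bad, ∫⁻ x', maxGhostWeight 𝓔 (Sum.elim x x') ∂μ ∂μ := by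
        refine setLIntegral_mono' .of_discrete ?_
        rintro x ⟨E, hE, hx, hε⟩
        calc (1 + ε) ^ Fintype.card ι ≤ (1 + D E) ^ Fintype.card ι := by gcongr
          _ ≤ _ := one_add_pow_le_lintegral_maxGhostWeight D hE .of_discrete hx
    _ ≤ ∫⁻ x, ∫⁻ x', maxGhostWeight 𝓔 (Sum.elim x x') ∂μ ∂μ := setLIntegral_le_lintegral _ _
    _ = ∫⁻ p, maxGhostWeight 𝓔 (Sum.elim p.1 p.2) ∂(μ.prod μ) :=
        (lintegral_prod (fun p : (ι → X) × (ι → X) => maxGhostWeight 𝓔 (Sum.elim p.1 p.2))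
          Measurable.of_discrete.aemeasurable).symm
    _ = ∫⁻ y, maxGhostWeight 𝓔 y ∂(Measure.pi fun _ : ι ⊕ ι => D) := by
        rw [← hsplit.lintegral_comp .of_discrete]
        rfl
    _ ≤ N := lintegral_maxGhostWeight_le D hN

theorem measure_exists_consistent_le (D : Measure X) [IsProbabilityMeasure D] {H : Set (X → Y)}
    {N : ℕ} (hN : ∀ S : ι ⊕ ι → X, ((fun h i => h (S i)) '' H).encard ≤ N) (c : X → Y)
    (ε : ℝ≥0∞) :
    Measure.pi (fun _ : ι => D)
        {x | ∃ h ∈ H, (∀ i, h (x i) = c (x i)) ∧ ε ≤ D {y | h y ≠ c y}} ≤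
      N / (1 + ε) ^ Fintype.card ι := by
  let errorSet (h : X → Y) : Set X := {y | h y ≠ c y}
  have htrace : ∀ y : ι ⊕ ι → X, ((fun E => y ⁻¹' E) '' (errorSet '' H)).encard ≤ N := fun y => by
    have himage : (fun E => y ⁻¹' E) '' (errorSet '' H) =
        (fun v => {j | v j ≠ c (y j)}) '' ((fun h i => h (y i)) '' H) := by
      simp only [Set.image_image]
      rfl
    rw [himage]
    exact (Set.encard_image_le _ _).trans (hN y)
  simpa [errorSet] using measure_exists_disjoint_le D htrace ε

end GhostSample

section SampleComplexity

theorem exp_half_le_one_add {ε : ℝ} (hε₀ : 0 ≤ ε) (hε₁ : ε ≤ 1) : Real.exp (ε / 2) ≤ 1 + ε := by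
  refine (Real.exp_bound_div_one_sub_of_interval (by linarith) (by linarith)).trans ?_
  rw [div_le_iff₀ (by linarith)]
  nlinarith

theorem sauerSum_le_mul_one_add_pow {d T m : ℕ} {ε δ : ℝ} (hT : 1 ≤ T) (hε₀ : 0 < ε)
    (hε₁ : ε ≤ 1) (hδ : 0 < δ)
    (hm : 4 / ε * (d * Real.log (8 * T / ε) + Real.log δ⁻¹) ≤ m) :
    (sauerSum 1 ((m + m) * T) (d + 1) : ℝ) ≤ δ * (1 + ε) ^ m := by
  have hT₁ : (1 : ℝ) ≤ T := by exact_mod_cast hT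
  have hT₀ : (0 : ℝ) < T := by linarith
  set x : ℝ := (8 * T / ε)⁻¹ with hx
  have hx₀ : 0 < x := by positivity
  have hx₁ : x ≤ 1 := inv_le_one_of_one_le₀ <| by
    rw [one_le_div hε₀]
    linarith
  have hδx : Real.exp (-(m * ε / 4)) ≤ δ * x ^ d := by
    rw [← Real.le_log_iff_exp_le (by positivity), Real.log_mul hδ.ne' (by positivity),
      Real.log_pow, hx, Real.log_inv]
    rw [div_mul_eq_mul_div, div_le_iff₀ hε₀, Real.log_inv] at hm
    linarith
  have hpow : Real.exp (m * ε / 2) ≤ (1 + ε) ^ m := by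
    rw [mul_div_assoc, Real.exp_nat_mul]
    gcongr
    exact exp_half_le_one_add hε₀.le hε₁
  refine le_of_mul_le_mul_right ?_ (pow_pos hx₀ d)
  calc (sauerSum 1 ((m + m) * T) (d + 1) : ℝ) * x ^ d
      ≤ Real.exp (((m + m) * T : ℕ) * (1 : ℕ) * x) := sauerSum_mul_pow_le_exp _ _ _ hx₀.le hx₁
    _ = Real.exp (-(m * ε / 4)) * Real.exp (m * ε / 2) := by
        rw [← Real.exp_add, hx]
        congr 1
        push_cast
        field_simp
        ring
    _ ≤ δ * x ^ d * (1 + ε) ^ m := by gcongr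
    _ = δ * (1 + ε) ^ m * x ^ d := by ring

/-- A sample size that suffices to learn end-to-end a class of Littlestone dimension `d`. A class
of dimension `0` has at most one member and needs no sample; rounding up to a sample of size one
would exceed the bound of the theorem, which tends to `0` as `δ` tends to `1`. -/
noncomputable def e2eSampleSize (d T : ℕ) (ε δ : ℝ) : ℕ :=
  if d = 0 then 0 else ⌈4 / ε * (d * Real.log (8 * T / ε) + Real.log δ⁻¹)⌉₊

theorem log_mul_div_le {ε₀ ε t : ℝ} (h₀ : 0 < ε₀) (h₁ : ε₀ < 1) (hε : 0 < ε) (hε₀ : ε ≤ ε₀)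
    (ht : 2 ≤ t) :
    Real.log (8 * t / ε) ≤ (2 + 4 / Real.log ε₀⁻¹) * (Real.log t * Real.log ε⁻¹) := by
  set l := Real.log ε₀⁻¹
  set A := Real.log t
  set B := Real.log ε⁻¹
  have hl : 0 < l := Real.log_pos (one_lt_inv₀ h₀ |>.2 h₁)
  have hlB : l ≤ B := Real.log_le_log (by positivity) (by gcongr)
  have h2A : Real.log 2 ≤ A := Real.log_le_log two_pos ht
  have hA : 1 / 2 ≤ A := by linarith [Real.log_two_gt_d9]
  have hAB : A ≤ A * B / l := (le_div_iff₀ hl).2 (by gcongr)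
  calc Real.log (8 * t / ε) = 3 * Real.log 2 + A + B := by
        rw [div_eq_mul_inv, Real.log_mul (by positivity) (by positivity),
          Real.log_mul (by norm_num) (by positivity), show (8 : ℝ) = 2 ^ 3 by norm_num,
          Real.log_pow, Nat.cast_ofNat]
    _ ≤ 4 * A + B := by linarith
    _ ≤ 4 * (A * B / l) + 2 * (A * B) := by nlinarith
    _ = (2 + 4 / l) * (A * B) := by ring

theorem one_le_mul_log_mul_log {ε₀ ε t : ℝ} (h₀ : 0 < ε₀) (h₁ : ε₀ < 1) (hε : 0 < ε)
    (hε₀ : ε ≤ ε₀) (ht : 2 ≤ t) :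
    1 ≤ 2 / Real.log ε₀⁻¹ * (Real.log t * Real.log ε⁻¹) := by
  have hl : 0 < Real.log ε₀⁻¹ := Real.log_pos (one_lt_inv₀ h₀ |>.2 h₁)
  have hlB : Real.log ε₀⁻¹ ≤ Real.log ε⁻¹ := Real.log_le_log (by positivity) (by gcongr)
  have hA : 1 / 2 ≤ Real.log t := by
    linarith [Real.log_two_gt_d9, Real.log_le_log two_pos ht]
  rw [div_mul_eq_mul_div, one_le_div hl]
  nlinarith

theorem e2eSampleSize_le {ε₀ ε δ : ℝ} (h₀ : 0 < ε₀) (h₁ : ε₀ < 1) (hε : 0 < ε) (hε₀ : ε ≤ ε₀)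
    (hδ₀ : 0 < δ) (hδ₁ : δ < 1) (d : ℕ) {T : ℕ} (hT : 2 ≤ T) :
    (e2eSampleSize d T ε δ : ℝ) ≤
      (8 + 18 / Real.log ε₀⁻¹) *
        (ε⁻¹ * (d * Real.log T * Real.log ε⁻¹ + Real.log δ⁻¹)) := by
  have hT' : (2 : ℝ) ≤ T := by exact_mod_cast hT
  have hl : 0 < Real.log ε₀⁻¹ := Real.log_pos (one_lt_inv₀ h₀ |>.2 h₁)
  have hδ : 0 < Real.log δ⁻¹ := Real.log_pos (one_lt_inv₀ hδ₀ |>.2 hδ₁)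
  rcases Nat.eq_zero_or_pos d with rfl | hd
  · simp only [e2eSampleSize, if_true, Nat.cast_zero, zero_mul, zero_add]
    positivity
  have hd' : (1 : ℝ) ≤ d := by exact_mod_cast hd
  have hlog := log_mul_div_le h₀ h₁ hε hε₀ hT'
  have hlog₀ : 0 ≤ Real.log (8 * T / ε) :=
    Real.log_nonneg ((one_le_div hε).2 (by linarith))
  set l := Real.log ε₀⁻¹
  set L := Real.log T * Real.log ε⁻¹
  have hround : 1 ≤ ε⁻¹ * (d * (2 / l * L)) :=
    one_le_mul_of_one_le_of_one_le ((one_le_inv₀ hε).2 (by linarith))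
      (one_le_mul_of_one_le_of_one_le hd' (one_le_mul_log_mul_log h₀ h₁ hε hε₀ hT'))
  calc (e2eSampleSize d T ε δ : ℝ)
      = ⌈4 / ε * (d * Real.log (8 * T / ε) + Real.log δ⁻¹)⌉₊ := by
        rw [e2eSampleSize, if_neg hd.ne']
    _ ≤ 4 / ε * (d * Real.log (8 * T / ε) + Real.log δ⁻¹) + 1 :=
        (Nat.ceil_lt_add_one (by positivity)).le
    _ ≤ 4 / ε * (d * ((2 + 4 / l) * L) + Real.log δ⁻¹) + ε⁻¹ * (d * (2 / l * L)) := by gcongr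
    _ = ε⁻¹ * ((8 + 18 / l) * (d * L) + 4 * Real.log δ⁻¹) := by ring
    _ ≤ ε⁻¹ * ((8 + 18 / l) * (d * L) + (8 + 18 / l) * Real.log δ⁻¹) := by
        gcongr
        linarith [div_pos (by norm_num : (0 : ℝ) < 18) hl]
    _ = _ := by ring

end SampleComplexity

section Consistency

variable {F : Set (List Bool → Bool)} {T : ℕ} {R : LearningRule} {f : List Bool → Bool} {d : ℕ}

theorem exists_isConsE2E (F : Set (List Bool → Bool)) (T : ℕ) :
    ∃ R : LearningRule, IsConsE2E F T R := by
  classical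
  exact ⟨fun S => if h : ∃ f ∈ F, ∀ p ∈ S, e2e f T p.1 = p.2 then e2e h.choose T
    else fun _ => false, fun S h => ⟨h.choose, h.choose_spec.1, dif_pos h, h.choose_spec.2⟩⟩

theorem IsConsE2E.exists_eq (hR : IsConsE2E F T R) (hf : f ∈ F) {n : ℕ}
    (x : Fin n → List Bool) :
    ∃ g ∈ F, R (e2eSample f T x) = e2e g T ∧ ∀ i, e2e g T (x i) = e2e f T (x i) := by
  simpa [e2eSample] using hR (e2eSample f T x) ⟨f, hf, by simp [e2eSample]⟩

theorem IsConsE2E.popError_eq_zero (hR : IsConsE2E F T R) (hF : F.Subsingleton) (hf : f ∈ F)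
    (D : Measure (List Bool)) {n : ℕ} (x : Fin n → List Bool) :
    popError D f T (R (e2eSample f T x)) = 0 := by
  obtain ⟨g, hg, hRg, -⟩ := hR.exists_eq hf x
  obtain rfl := hF hf hg
  simp [popError, hRg]

theorem IsConsE2E.measureReal_lt_popError_le (hR : IsConsE2E F T R)
    (hF : ¬ LittlestoneShatters (d + 1) F) (hT : 1 ≤ T) (hf : f ∈ F)
    (D : Measure (List Bool)) [IsProbabilityMeasure D] (m : ℕ) {ε : ℝ} (hε : 0 ≤ ε) :
    (Measure.pi fun _ : Fin m => D).real {x | ε < popError D f T (R (e2eSample f T x))} ≤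
      sauerSum 1 ((m + m) * T) (d + 1) / (1 + ε) ^ m := by
  have hgrowth : ∀ S : Fin m ⊕ Fin m → List Bool,
      ((fun h i => h (S i)) '' e2eClass F T).encard ≤ sauerSum 1 ((m + m) * T) (d + 1) := by
    intro S
    simpa using encard_image_e2eClass_le hF hT S
  have hbad := measure_exists_consistent_le D hgrowth (e2e f T) (ENNReal.ofReal ε)
  have hsub : {x : Fin m → List Bool | ε < popError D f T (R (e2eSample f T x))} ⊆
      {x | ∃ h ∈ e2eClass F T, (∀ i, h (x i) = e2e f T (x i)) ∧
        ENNReal.ofReal ε ≤ D {y | h y ≠ e2e f T y}} := by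
    intro x hx
    obtain ⟨g, hg, hRg, hcons⟩ := hR.exists_eq hf x
    have herror : ε < D.real {y | e2e g T y ≠ e2e f T y} := hRg ▸ hx
    exact ⟨e2e g T, ⟨g, hg, rfl⟩, hcons, ENNReal.ofReal_le_of_le_toReal herror.le⟩
  refine ENNReal.toReal_le_of_le_ofReal (by positivity) ?_
  refine ((measure_mono hsub).trans hbad).trans_eq ?_
  rw [Fintype.card_fin, ENNReal.ofReal_div_of_pos (by positivity), ENNReal.ofReal_natCast,
    ENNReal.ofReal_pow (by positivity), ENNReal.ofReal_add zero_le_one hε, ENNReal.ofReal_one]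

theorem IsConsE2E.e2eLearns (hR : IsConsE2E F T R) (hF : ¬ LittlestoneShatters (d + 1) F)
    (hT : 1 ≤ T) : E2ELearns F T R (e2eSampleSize d T) := by
  intro D _ f hf ε δ hε hε₁ hδ _
  rcases Nat.eq_zero_or_pos d with rfl | hd
  · simp [hR.popError_eq_zero (subsingleton_of_not_littlestoneShatters_one hF) hf, hε.le, hδ.le]
  set m := e2eSampleSize d T ε δ with hm
  set μ := Measure.pi fun _ : Fin m => D
  set good : Set (Fin m → List Bool) := {x | popError D f T (R (e2eSample f T x)) ≤ ε}
  have hgoodc : goodᶜ = {x | ε < popError D f T (R (e2eSample f T x))} :=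
    by
    ext
    simp [good]
  have hmle : 4 / ε * (d * Real.log (8 * T / ε) + Real.log δ⁻¹) ≤ m := by
    rw [hm, e2eSampleSize, if_neg hd.ne']
    exact Nat.le_ceil _
  have hbad : μ.real goodᶜ ≤ δ := by
    rw [hgoodc]
    exact (hR.measureReal_lt_popError_le hF hT hf D m hε.le).trans <|
      (div_le_iff₀ (by positivity)).2 (sauerSum_le_mul_one_add_pow hT hε hε₁.le hδ hmle)
  have hcompl : μ.real goodᶜ = 1 - μ.real good := probReal_compl_eq_one_sub .of_discrete
  linarith

end Consistency

end AutoregressiveCoT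

theorem mainTheorem5 :
    -- binary alphabet: VC dimension of the end-to-end class
    (∀ (F : Set (List Bool → Bool)) (T : ℕ), 2 ≤ T →
      (vcDim (e2eClass F T) : ℝ≥0∞) ≤ 10 * (ldim F : ℝ≥0∞) * ENNReal.ofReal (Real.log T)) ∧
    -- alphabet of any finite size `k`: Natarajan dimension of the end-to-end class
    (∀ (k : ℕ) (F : Set (List (Fin k) → Fin k)) (T : ℕ), 1 ≤ T →
      (natarajanDim (e2eClass F T) : ℝ≥0∞) ≤
        20 * (sfatDim 1 (realClass F) : ℝ≥0∞) * ENNReal.ofReal (Real.log ((T : ℝ) * k))) ∧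
    -- binary alphabet: sample complexity of the end-to-end consistency rule
    (∀ ε₀ : ℝ, 0 < ε₀ → ε₀ < 1 → ∃ C : ℝ, 0 < C ∧
      ∀ (F : Set (List Bool → Bool)) (d : ℕ), ldim F = (d : ℕ∞) → ∀ T : ℕ, 2 ≤ T →
        ∃ m : ℝ → ℝ → ℕ,
          (∃ R : LearningRule, IsConsE2E F T R) ∧
          (∀ R : LearningRule, IsConsE2E F T R → E2ELearns F T R m) ∧
          ∀ ε δ : ℝ, 0 < ε → ε ≤ ε₀ → 0 < δ → δ < 1 →
            (m ε δ : ℝ) ≤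
              C * (ε⁻¹ * ((d : ℝ) * Real.log T * Real.log ε⁻¹ + Real.log δ⁻¹))) := by
  refine ⟨fun F T hT => (vcDim_e2eClass_le F hT).trans ?_, fun k F T hT => ?_,
    fun ε₀ h₀ h₁ => ⟨8 + 18 / Real.log ε₀⁻¹, ?_, fun F d hd T hT => ?_⟩⟩
  · gcongr
    exact littlestoneDim_le_ldim F
  · refine (natarajanDim_e2eClass_le F hT).trans ?_
    rw [Fintype.card_fin]
    gcongr
    · norm_num
    · exact littlestoneDim_le_sfatDim F
  · have hlog : 0 < Real.log ε₀⁻¹ := Real.log_pos ((one_lt_inv₀ h₀).2 h₁)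
    positivity
  · have hF : ¬ LittlestoneShatters (d + 1) F :=
      not_littlestoneShatters_succ ((littlestoneDim_le_ldim F).trans hd.le)
    exact ⟨e2eSampleSize d T, exists_isConsE2E F T, fun R hR => hR.e2eLearns hF (by omega),
      fun ε δ hε hε₀ hδ₀ hδ₁ => e2eSampleSize_le h₀ h₁ hε hε₀ hδ₀ hδ₁ d hT⟩
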